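/- Let $k$ be a perfect field; a $k$-variety is an integral separated scheme of finite type over $k$. Let $f\colon X\to Y$ be a finite, surjective and separable $k$-morphism of normal projective $k$-varieties (separable means that the field extension $k(Y)\subseteq k(X)$ is separable). Then for every $\mathbb{Q}$-divisor $D$ on $Y$, i.e. every element $D\in \mathrm{Div}(Y)\otimes_{\mathbb Z}\mathbb{Q}$, where $\mathrm{Div}(Y)$ is the group of Cartier divisors on $Y$, there is an equality of reduced closed subschemes of $X$ \[ \mathbf{B}(f^*D) = f^{-1}\mathbf{B}(D). \] Here, for a Cartier divisor $L$, the stable base locus is $\mathbf{B}(L) = \bigl(\bigcap_{m\ge 1}\mathrm{Bs}(mL)\bigr)_{\mathrm{red}}$, where $\mathrm{Bs}(mL)$ is the base locus of the complete linear system $|mL|$, i.e. the set of points at which all global sections of $\mathcal{O}(mL)$ vanish. For a $\mathbb{Q}$-divisor $D$, $\mathbf{B}(D) := \mathbf{B}(bD)$ for any integer $b>0$ such that $bD$ is Cartier (this does not depend on $b$). Finally, $f^{-1}\mathbf{B}(D)$ denotes the reduced scheme associated to the scheme-theoretic inverse image of $\mathbf{B}(D)$. -/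

import Mathlib

open AlgebraicGeometry CategoryTheory TopologicalSpace

universe u

noncomputable section

namespace BaseLoci

/-! ### Projective, normal and separable -/

section Projective

attribute [local instance] MvPolynomial.gradedAlgebra

/-- Projective `n`-space `Proj k[x₀, …, xₙ]` over `k`. -/
def projectiveSpace (k : Type u) [Field k] (n : ℕ) : Scheme.{u} :=
  Proj (MvPolynomial.homogeneousSubmodule (Fin (n + 1)) k)

/-- The structure morphism of projective `n`-space over `k`. -/
def projectiveSpaceStr (k : Type u) [Field k] (n : ℕ) :
    projectiveSpace k n ⟶ Spec (CommRingCat.of k) :=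
  Proj.toSpecZero (MvPolynomial.homogeneousSubmodule (Fin (n + 1)) k) ≫
    Spec.map (CommRingCat.ofHom
      (algebraMap k (MvPolynomial.homogeneousSubmodule (Fin (n + 1)) k 0)))

end Projective

/-- A `k`-scheme is projective if it is isomorphic, over `k`, to a closed subscheme of some
projective space over `k`. Such a scheme is separated and of finite type over `k`. -/
def IsProjective (k : Type u) [Field k] (X : Scheme.{u}) [X.Over (Spec (CommRingCat.of k))] :
    Prop :=
  ∃ (n : ℕ) (i : X ⟶ projectiveSpace k n), IsClosedImmersion i ∧
    i ≫ projectiveSpaceStr k n = X ↘ Spec (CommRingCat.of k)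

/-- An integral scheme is normal if all of its local rings are integrally closed domains. -/
def IsNormal (X : Scheme.{u}) [IsIntegral X] : Prop :=
  ∀ x : X, IsIntegrallyClosed (X.presheaf.stalk x)

variable {X Y : Scheme.{u}} [IsIntegral X] [IsIntegral Y]

lemma genericPoint_map (f : X ⟶ Y) [IsDominant f] : f (genericPoint X) = genericPoint Y := by
  apply ((genericPoint_spec Y).eq _).symm
  have h := (genericPoint_spec X).image f.continuous
  rwa [Set.image_univ, f.denseRange.closure_range] at h

/-- The inclusion of function fields `k(Y) → k(X)` induced by a dominant morphism `X ⟶ Y`. -/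
def functionFieldMap (f : X ⟶ Y) [IsDominant f] : Y.functionField →+* X.functionField :=
  (Y.presheaf.stalkSpecializes (specializes_of_eq (genericPoint_map f)) ≫
    f.stalkMap (genericPoint X)).hom

/-- A dominant morphism of integral schemes is (generically) separable if the induced extension
of function fields is a separable algebraic extension. -/
def IsSeparableMorphism (f : X ⟶ Y) [IsDominant f] : Prop :=
  letI : Algebra Y.functionField X.functionField := (functionFieldMap f).toAlgebra
  Algebra.IsSeparable Y.functionField X.functionField

lemma functionFieldMap_algebraMap (f : X ⟶ Y) [IsDominant f] (x : X)
    (a : Y.presheaf.stalk (f x)) :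
    functionFieldMap f (algebraMap (Y.presheaf.stalk (f x)) Y.functionField a) =
      algebraMap (X.presheaf.stalk x) X.functionField (f.stalkMap x a) := by
  have h := f.stalkSpecializes_stalkMap (genericPoint X) x
    ((genericPoint_spec X).specializes trivial)
  have h2 := congr($h a)
  have h3 : Y.presheaf.stalkSpecializes ((genericPoint_spec Y).specializes trivial) ≫
      Y.presheaf.stalkSpecializes (specializes_of_eq (genericPoint_map f)) =
      Y.presheaf.stalkSpecializes
        (((genericPoint_spec X).specializes (Set.mem_univ x)).map f.continuous) := by
    simp
  have h4 := congr($h3 a)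
  simp only [CommRingCat.comp_apply] at h2 h4
  simp only [RingHom.algebraMap_toAlgebra, functionFieldMap, CommRingCat.comp_apply]
  rw [← h2, ← h4]

/-! ### Cartier divisors -/

variable (Y) in
/-- The image of `𝒪_{Y,y}ˣ` in `k(Y)ˣ`. -/
def stalkUnits (y : Y) : Subgroup (Y.functionField)ˣ :=
  (Units.map (algebraMap (Y.presheaf.stalk y) Y.functionField).toMonoidHom).range

variable (Y) in
/-- The group `Γ(Y, 𝒦ˣ/𝒪ˣ)`, written multiplicatively. On the integral scheme `Y` the sheaf `𝒦`
is the constant sheaf `k(Y)` and the stalk of `𝒦ˣ/𝒪ˣ` at `y` is `k(Y)ˣ/𝒪_{Y,y}ˣ`; a global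
section of the quotient sheaf is a family of elements of the stalks that is locally given by
one rational function. -/
def cartierGroup : Subgroup (∀ y : Y, (Y.functionField)ˣ ⧸ stalkUnits Y y) where
  carrier := {L | ∀ y : Y, ∃ U : Y.Opens, y ∈ U ∧ ∃ φ : (Y.functionField)ˣ,
    ∀ z ∈ U, L z = QuotientGroup.mk φ}
  mul_mem' := by
    intro L M hL hM y
    obtain ⟨U, hU, φ, hφ⟩ := hL y
    obtain ⟨V, hV, ψ, hψ⟩ := hM y
    exact ⟨U ⊓ V, ⟨hU, hV⟩, φ * ψ, fun z hz => by
      rw [Pi.mul_apply, hφ z hz.1, hψ z hz.2]; rfl⟩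
  one_mem' := fun y => ⟨⊤, trivial, 1, fun z _ => rfl⟩
  inv_mem' := by
    intro L hL y
    obtain ⟨U, hU, φ, hφ⟩ := hL y
    exact ⟨U, hU, φ⁻¹, fun z hz => by rw [Pi.inv_apply, hφ z hz]; rfl⟩

variable (Y) in
/-- The additive group `Div(Y)` of Cartier divisors on the integral scheme `Y`. -/
def CartierDivisor : Type u := Additive (cartierGroup Y)

instance : AddCommGroup (CartierDivisor Y) :=
  inferInstanceAs (AddCommGroup (Additive (cartierGroup Y)))

/-- `φ ∈ k(Y)ˣ` is a local equation of the Cartier divisor `L` at `y`. -/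
def IsLocalEquation (L : CartierDivisor Y) (y : Y) (φ : (Y.functionField)ˣ) : Prop :=
  (Additive.toMul L).1 y = QuotientGroup.mk φ

lemma stalkUnits_le_comap (f : X ⟶ Y) [IsDominant f] (x : X) :
    stalkUnits Y (f x) ≤
      (stalkUnits X x).comap (Units.map (functionFieldMap f).toMonoidHom) := by
  intro c hc
  obtain ⟨a, rfl⟩ := MonoidHom.mem_range.1 hc
  refine Subgroup.mem_comap.2
    (MonoidHom.mem_range.2 ⟨Units.map (f.stalkMap x).hom.toMonoidHom a, ?_⟩)
  ext
  exact (functionFieldMap_algebraMap f x a).symm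

/-- The map `k(Y)ˣ/𝒪_{Y,f(x)}ˣ → k(X)ˣ/𝒪_{X,x}ˣ` induced by `f`. -/
def stalkPullback (f : X ⟶ Y) [IsDominant f] (x : X) :
    (Y.functionField)ˣ ⧸ stalkUnits Y (f x) →* (X.functionField)ˣ ⧸ stalkUnits X x :=
  QuotientGroup.map _ _ (Units.map (functionFieldMap f).toMonoidHom) (stalkUnits_le_comap f x)

/-- The pullback of Cartier divisors along a dominant morphism of integral schemes: a local
equation `φ` of `L` at `f x` gives the local equation `f^* φ` of `f^* L` at `x`. -/
def pullback (f : X ⟶ Y) [IsDominant f] : CartierDivisor Y →+ CartierDivisor X :=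
  MonoidHom.toAdditive (α := cartierGroup Y) (β := cartierGroup X)
    { toFun := fun L => ⟨fun x => stalkPullback f x (L.1 (f x)), by
        intro x
        obtain ⟨U, hU, φ, hφ⟩ := L.2 (f x)
        refine ⟨f ⁻¹ᵁ U, hU, Units.map (functionFieldMap f).toMonoidHom φ, fun z hz => ?_⟩
        exact congrArg (stalkPullback f z) (hφ (f z) hz)⟩
      map_one' := Subtype.ext (funext fun x => map_one (stalkPullback f x))
      map_mul' := fun L M => Subtype.ext (funext fun x => map_mul (stalkPullback f x) _ _) }

/-! ### Base loci of Cartier divisors -/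

/-- `H⁰(Y, 𝒪_Y(L))` as a subgroup of `k(Y)`: the rational functions `g` such that `g φ` is regular
at `y` whenever `φ` is a local equation of `L` at `y`. -/
def globalSections (L : CartierDivisor Y) : AddSubgroup Y.functionField where
  carrier := {g | ∀ (y : Y) (φ : (Y.functionField)ˣ), IsLocalEquation L y φ →
    ∃ a : Y.presheaf.stalk y, algebraMap _ Y.functionField a = g * φ}
  add_mem' := by
    intro g h hg hh y φ hφ
    obtain ⟨a, ha⟩ := hg y φ hφ
    obtain ⟨b, hb⟩ := hh y φ hφ
    exact ⟨a + b, by rw [map_add, ha, hb, add_mul]⟩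
  zero_mem' := fun y φ _ => ⟨0, by simp⟩
  neg_mem' := by
    intro g hg y φ hφ
    obtain ⟨a, ha⟩ := hg y φ hφ
    exact ⟨-a, by rw [map_neg, ha, neg_mul]⟩

/-- The section `g` of `𝒪_Y(L)` vanishes at `y`: in terms of a local equation `φ` of `L` at `y`,
the germ `g φ` lies in the maximal ideal of `𝒪_{Y,y}`. -/
def VanishesAt (L : CartierDivisor Y) (g : Y.functionField) (y : Y) : Prop :=
  ∀ φ : (Y.functionField)ˣ, IsLocalEquation L y φ →
    ∃ a ∈ IsLocalRing.maximalIdeal (Y.presheaf.stalk y),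
      algebraMap _ Y.functionField a = g * φ

lemma exists_isLocalEquation (L : CartierDivisor Y) (y : Y) : ∃ φ, IsLocalEquation L y φ := by
  obtain ⟨U, hU, φ, hφ⟩ := (Additive.toMul L).2 y
  exact ⟨φ, hφ y hU⟩

lemma algebraMap_stalk_injective (y : Y) :
    Function.Injective (algebraMap (Y.presheaf.stalk y) Y.functionField) :=
  IsFractionRing.injective _ _

/-- A section does not vanish at `y` iff its germ in terms of some local equation is a unit. -/
lemma not_vanishesAt_iff {L : CartierDivisor Y} {g : Y.functionField}
    (hg : g ∈ globalSections L) (y : Y) :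
    ¬ VanishesAt L g y ↔ ∃ φ, IsLocalEquation L y φ ∧
      ∃ u : (Y.presheaf.stalk y)ˣ, algebraMap _ Y.functionField (u : Y.presheaf.stalk y) = g * φ := by
  constructor
  · intro h
    simp only [VanishesAt, not_forall] at h
    obtain ⟨φ, hφ, h⟩ := h
    obtain ⟨a, ha⟩ := hg y φ hφ
    have hu : IsUnit a := by
      by_contra hn
      exact h ⟨a, (IsLocalRing.mem_maximalIdeal a).2 hn, ha⟩
    exact ⟨φ, hφ, hu.unit, ha⟩
  · rintro ⟨φ, hφ, u, hu⟩ h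
    obtain ⟨a, ham, ha⟩ := h φ hφ
    have : a = u := algebraMap_stalk_injective y (ha.trans hu.symm)
    exact (IsLocalRing.mem_maximalIdeal a).1 ham (this ▸ u.isUnit)

lemma algebraMap_germ (y : Y) (U : Y.Opens) (hy : y ∈ U) (hgen : genericPoint Y ∈ U)
    (s : Γ(Y, U)) : algebraMap (Y.presheaf.stalk y) Y.functionField (Y.presheaf.germ U y hy s) =
      Y.presheaf.germ U (genericPoint Y) hgen s := by
  simp [RingHom.algebraMap_toAlgebra, ← ConcreteCategory.comp_apply]

lemma isOpen_nonvanishing {L : CartierDivisor Y} {g : Y.functionField}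
    (hg : g ∈ globalSections L) : IsOpen {y | ¬ VanishesAt L g y} := by
  rw [isOpen_iff_forall_mem_open]
  intro y hy
  obtain ⟨φ, hφ, u, hu⟩ := (not_vanishesAt_iff hg y).1 hy
  obtain ⟨U, hyU, ψ, hψ⟩ := (Additive.toMul L).2 y
  -- replace `φ` by the local equation `ψ`, valid on all of `U`
  obtain ⟨c, hc⟩ : φ⁻¹ * ψ ∈ stalkUnits Y y := QuotientGroup.eq.1 (hφ.symm.trans (hψ y hyU))
  have hu' : algebraMap _ Y.functionField ((u * c : (Y.presheaf.stalk y)ˣ) : Y.presheaf.stalk y)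
      = g * ψ := by
    have hc' : algebraMap _ Y.functionField (c : Y.presheaf.stalk y) =
        ((φ⁻¹ * ψ : (Y.functionField)ˣ) : Y.functionField) := congrArg Units.val hc
    rw [Units.val_mul, map_mul, hu, hc', Units.val_mul, mul_assoc, ← mul_assoc (φ : Y.functionField),
      Units.mul_inv, one_mul]
  obtain ⟨V, hyV, s, hs⟩ := Y.presheaf.exists_germ_eq
    ((u * c : (Y.presheaf.stalk y)ˣ) : Y.presheaf.stalk y)
  have hmem : ∀ W : Y.Opens, ∀ z ∈ W, genericPoint Y ∈ W := fun W z hz =>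
    ((genericPoint_spec Y).mem_open_set_iff W.isOpen).2 ⟨z, trivial, hz⟩
  refine ⟨(Y.basicOpen s ⊓ U : Y.Opens), ?_, (Y.basicOpen s ⊓ U).isOpen, ?_, hyU⟩
  · rintro z ⟨hzs, hzU⟩
    have hzV : z ∈ V := Y.basicOpen_le s hzs
    have hunit := (Scheme.mem_basicOpen Y s z hzV).1 hzs
    refine (not_vanishesAt_iff hg z).2 ⟨ψ, hψ z hzU, hunit.unit, ?_⟩
    rw [← hu', ← hs, IsUnit.unit_spec, algebraMap_germ z V hzV (hmem V z hzV),
      algebraMap_germ y V hyV (hmem V z hzV)]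
  · refine (Scheme.mem_basicOpen Y s y hyV).2 ?_
    rw [hs]
    exact Units.isUnit _

/-- The base locus of the complete linear system `|L|`, as a closed subset: the common zeros of
all global sections of `𝒪_Y(L)`. -/
def baseLocus (L : CartierDivisor Y) : Closeds Y where
  carrier := {y | ∀ g ∈ globalSections L, VanishesAt L g y}
  isClosed' := by
    rw [← isOpen_compl_iff]
    have : {y | ∀ g ∈ globalSections L, VanishesAt L g y}ᶜ =
        ⋃ g : globalSections L, {y | ¬ VanishesAt L g.1 y} := by
      ext y; simp
    rw [this]
    exact isOpen_iUnion fun g => isOpen_nonvanishing g.2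

/-- The stable base locus of a Cartier divisor, as a closed subset: the intersection of the base
loci of all its positive multiples. -/
def stableBaseSet (L : CartierDivisor Y) : Closeds Y :=
  ⨅ m : ℕ+, baseLocus ((m : ℕ) • L)

/-! ### `ℚ`-divisors and their stable base loci -/

open scoped TensorProduct

variable (Y) in
/-- The group `Div(Y) ⊗ ℚ` of `ℚ`-divisors. -/
abbrev QDivisor : Type u := CartierDivisor Y ⊗[ℤ] ℚ

/-- The pullback of `ℚ`-divisors along a dominant morphism of integral schemes. -/
def QDivisor.pullback (f : X ⟶ Y) [IsDominant f] : QDivisor Y →ₗ[ℤ] QDivisor X :=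
  (BaseLoci.pullback f).toIntLinearMap.rTensor ℚ

/-- The stable base locus of a `ℚ`-divisor `D`, as a closed subset: it is the stable base locus
of the Cartier divisor `L` for every `b > 0` and `L` such that `b D = L` in `Div(Y) ⊗ ℚ`. As this
does not depend on `b` and `L` (see `QDivisor.stableBaseSet_eq` and `QDivisor.exists_cartier`), we
take the intersection over all choices. -/
def QDivisor.stableBaseSet (D : QDivisor Y) : Closeds Y :=
  ⨅ (b : ℕ+) (L : CartierDivisor Y) (_ : (b : ℕ) • D = L ⊗ₜ[ℤ] (1 : ℚ)), BaseLoci.stableBaseSet L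

lemma isLocalEquation_nsmul {L : CartierDivisor Y} {y : Y} {φ : (Y.functionField)ˣ}
    (h : IsLocalEquation L y φ) (n : ℕ) : IsLocalEquation (n • L) y (φ ^ n) := by
  change ((Additive.toMul L).1 y) ^ n = _
  rw [show (Additive.toMul L).1 y = QuotientGroup.mk φ from h]
  rfl

lemma exists_regular_of_isLocalEquation {L : CartierDivisor Y} {y : Y}
    {φ ψ : (Y.functionField)ˣ} (hφ : IsLocalEquation L y φ) (hψ : IsLocalEquation L y ψ)
    {g : Y.functionField} (h : ∃ a : Y.presheaf.stalk y, algebraMap _ Y.functionField a = g * φ) :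
    ∃ a : Y.presheaf.stalk y, algebraMap _ Y.functionField a = g * ψ := by
  obtain ⟨a, ha⟩ := h
  obtain ⟨c, hc⟩ : φ⁻¹ * ψ ∈ stalkUnits Y y := QuotientGroup.eq.1 (hφ.symm.trans hψ)
  have hc' : algebraMap _ Y.functionField (c : Y.presheaf.stalk y) =
      ((φ⁻¹ * ψ : (Y.functionField)ˣ) : Y.functionField) := congrArg Units.val hc
  refine ⟨a * c, ?_⟩
  rw [map_mul, ha, hc', Units.val_mul, mul_assoc, ← mul_assoc (φ : Y.functionField),
    Units.mul_inv, one_mul]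

lemma baseLocus_nsmul_le (L : CartierDivisor Y) (n : ℕ) :
    baseLocus (n • L) ≤ baseLocus L := by
  intro y hy g hg
  by_contra hv
  obtain ⟨φ, hφ, u, hu⟩ := (not_vanishesAt_iff hg y).1 hv
  have hgn : g ^ n ∈ globalSections (n • L) := by
    intro z ψ hψ
    obtain ⟨χ, hχ⟩ := exists_isLocalEquation L z
    obtain ⟨a, ha⟩ := hg z χ hχ
    exact exists_regular_of_isLocalEquation (isLocalEquation_nsmul hχ n) hψ
      ⟨a ^ n, by rw [map_pow, ha, mul_pow, Units.val_pow_eq_pow_val]⟩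
  refine (not_vanishesAt_iff hgn y).2 ⟨φ ^ n, isLocalEquation_nsmul hφ n, u ^ n, ?_⟩ (hy _ hgn)
  rw [Units.val_pow_eq_pow_val, map_pow, hu, mul_pow, Units.val_pow_eq_pow_val]

lemma stableBaseSet_nsmul (L : CartierDivisor Y) (n : ℕ+) :
    stableBaseSet ((n : ℕ) • L) = stableBaseSet L := by
  apply le_antisymm
  · refine le_iInf fun m => (iInf_le _ m).trans ?_
    rw [smul_comm]
    exact baseLocus_nsmul_le _ _
  · refine le_iInf fun m => (iInf_le _ (m * n)).trans ?_
    rw [PNat.mul_coe, mul_smul]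

lemma exists_nsmul_eq_of_tmul_eq {M : Type u} [AddCommGroup M] {L L' : M}
    (h : L ⊗ₜ[ℤ] (1 : ℚ) = L' ⊗ₜ[ℤ] (1 : ℚ)) : ∃ n : ℕ+, (n : ℕ) • L = (n : ℕ) • L' := by
  have h' : TensorProduct.mk ℤ ℚ M 1 L = TensorProduct.mk ℤ ℚ M 1 L' :=
    congrArg (TensorProduct.comm ℤ M ℚ) h
  obtain ⟨c, hc⟩ := (IsLocalizedModule.eq_iff_exists (nonZeroDivisors ℤ)
    (TensorProduct.mk ℤ ℚ M 1)).1 h'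
  have hc0 : (c : ℤ) ≠ 0 := nonZeroDivisors.ne_zero c.2
  refine ⟨⟨(c : ℤ).natAbs, Int.natAbs_pos.2 hc0⟩, ?_⟩
  change (c : ℤ) • L = (c : ℤ) • L' at hc
  rcases Int.natAbs_eq (c : ℤ) with h1 | h1
  · rw [h1, natCast_zsmul, natCast_zsmul] at hc
    exact hc
  · rw [h1, neg_smul, neg_smul, natCast_zsmul, natCast_zsmul] at hc
    exact neg_injective hc

/-- Every `ℚ`-divisor has a positive multiple that is Cartier. -/
lemma QDivisor.exists_cartier (D : QDivisor Y) :
    ∃ (b : ℕ+) (L : CartierDivisor Y), (b : ℕ) • D = L ⊗ₜ[ℤ] (1 : ℚ) := by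
  induction D using TensorProduct.induction_on with
  | zero => exact ⟨1, 0, by simp⟩
  | tmul L q =>
    refine ⟨⟨q.den, q.den_pos⟩, q.num • L, ?_⟩
    rw [TensorProduct.smul_tmul, ← TensorProduct.tmul_smul]
    congr 1
    simp [mul_comm, Rat.mul_den_eq_num]
  | add D E hD hE =>
    obtain ⟨b, L, hL⟩ := hD
    obtain ⟨c, M, hM⟩ := hE
    refine ⟨b * c, (c : ℕ) • L + (b : ℕ) • M, ?_⟩
    rw [TensorProduct.add_tmul, ← TensorProduct.smul_tmul', ← TensorProduct.smul_tmul', ← hL,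
      ← hM, PNat.mul_coe, smul_add, mul_smul (b : ℕ) (c : ℕ) E, mul_comm, mul_smul]

/-- The stable base locus of a `ℚ`-divisor does not depend on the chosen Cartier multiple. -/
lemma QDivisor.stableBaseSet_eq (D : QDivisor Y) (b : ℕ+) (L : CartierDivisor Y)
    (h : (b : ℕ) • D = L ⊗ₜ[ℤ] (1 : ℚ)) : D.stableBaseSet = BaseLoci.stableBaseSet L := by
  apply le_antisymm
  · exact (iInf_le _ b).trans ((iInf_le _ L).trans (iInf_le _ h))
  · refine le_iInf fun c => le_iInf fun M => le_iInf fun hM => ?_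
    have key : ((c : ℕ) • L) ⊗ₜ[ℤ] (1 : ℚ) = ((b : ℕ) • M) ⊗ₜ[ℤ] (1 : ℚ) := by
      rw [← TensorProduct.smul_tmul', ← TensorProduct.smul_tmul', ← h, ← hM, smul_comm]
    obtain ⟨n, hn⟩ := exists_nsmul_eq_of_tmul_eq key
    rw [← stableBaseSet_nsmul L c, ← stableBaseSet_nsmul _ n, hn, stableBaseSet_nsmul,
      stableBaseSet_nsmul]

/-- The stable base locus of a `ℚ`-divisor as a reduced closed subscheme of `Y`, given by its
ideal sheaf. -/
def QDivisor.stableBaseLocus (D : QDivisor Y) : Y.IdealSheafData :=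
  Scheme.IdealSheafData.vanishingIdeal D.stableBaseSet

/-- The reduced closed subscheme associated to the scheme-theoretic inverse image `f⁻¹ Z` of a
closed subscheme `Z` of `Y` (closed subschemes being given by their ideal sheaves). -/
def reducedPreimage (f : X ⟶ Y) (Z : Y.IdealSheafData) : X.IdealSheafData :=
  (Z.comap f).radical

end BaseLoci

end

/-!
A section of `L` vanishes at `f x` if and only if its pullback vanishes at `x`, whence
`𝐁(f^* L) ⊆ f⁻¹ 𝐁(L)`. Conversely, let `g ∈ k(X)` be a section of `f^* L`. As `f` is
universally closed, functions on the preimage of an affine open `V ⊆ Y` are integral over `𝒪(V)`;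
hence, for a local equation `φ` of `L` at `y`, the product `φ g` is integral over `𝒪_{Y,y}`.
Let `d` be the degree of the minimal polynomial of `g` over `k(Y)`. Normality of `Y` makes its
`i`-th coefficient a section of `(d - i) L`. If `f x ∈ 𝐁(L)`, then these sections vanish at `f x`
for all `i < d`, so the monic equation of `φ g` puts `(φ g) ^ d`, and with it `φ g`, into the
maximal ideal of `𝒪_{X,x}`: the section `g` vanishes at `x`.
-/

namespace BaseLoci

section IntegralDependence

open Polynomial

lemma isIntegral_of_isIntegral_smul {R K L : Type*} [CommRing R] [Field K] [Field L] [Algebra R K]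
    [Algebra K L] [Algebra R L] [IsScalarTower R K L] {c : K} (hc : c ≠ 0) {g : L}
    (h : IsIntegral R (c • g)) : IsIntegral K g := by
  simpa [hc] using (h.tower_top (A := K)).smul c⁻¹

lemma exists_algebraMap_eq_coeff_minpoly_mul_pow {R K L : Type*} [CommRing R] [IsDomain R]
    [IsIntegrallyClosed R] [Field K] [Field L] [Algebra R K] [IsFractionRing R K] [Algebra K L]
    [Algebra R L] [IsScalarTower R K L] {c : K} (hc : c ≠ 0) {g : L}
    (h : IsIntegral R (c • g)) (i : ℕ) :
    ∃ a : R, algebraMap R K a =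
      (minpoly K g).coeff i * c ^ ((minpoly K g).natDegree - i) := by
  have hg : IsIntegral K g := isIntegral_of_isIntegral_smul hc h
  refine ⟨(minpoly R (c • g)).coeff i, ?_⟩
  rw [← coeff_scaleRoots, ← IsIntegrallyClosed.minpoly_smul hc hg,
    minpoly.isIntegrallyClosed_eq_field_fractions' K h, coeff_map]

lemma mem_of_isWeaklyEisensteinAt_of_eval₂_eq_zero {R S : Type*} [CommRing R] [CommRing S]
    {φ : R →+* S} {I : Ideal R} {J : Ideal S} (hJ : J.IsRadical) (hIJ : I.map φ ≤ J)
    {P : R[X]} (hP : P.Monic) (hPI : P.IsWeaklyEisensteinAt I) {u : S}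
    (hu : P.eval₂ φ u = 0) : u ∈ J :=
  hJ ⟨_, hIJ <| (hPI.map φ).pow_natDegree_le_of_root_of_monic_mem
    ((IsRoot.def).2 <| (eval_map φ u).trans hu) (hP.map φ) _ le_rfl⟩

end IntegralDependence

variable {X Y : Scheme.{u}}

lemma isIntegral_app_of_universallyClosed (f : X ⟶ Y) [UniversallyClosed f] {V : Y.Opens}
    (hV : IsAffineOpen V) : (f.app V).hom.IsIntegral := by
  have : IsAffine V := hV
  suffices (f.app (V.ι ''ᵁ ⊤)).hom.IsIntegral by rwa [Scheme.Opens.ι_image_top] at this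
  exact (RingHom.isIntegral_respectsIso.cancel_right_isIso _ _).1
    (morphismRestrict_appTop f V ▸ isIntegral_appTop_of_universallyClosed (f ∣_ V))

lemma reducedPreimage_vanishingIdeal (f : X ⟶ Y) (Z : Closeds Y) :
    reducedPreimage f (Scheme.IdealSheafData.vanishingIdeal Z) =
      Scheme.IdealSheafData.vanishingIdeal (Z.preimage f.continuous) := by
  rw [reducedPreimage, ← Scheme.IdealSheafData.vanishingIdeal_support,
    Scheme.IdealSheafData.support_comap]
  congr

variable [IsIntegral X] [IsIntegral Y]

section RationalFunctions

lemma genericPoint_mem_of_mem {U : Y.Opens} {y : Y} (hy : y ∈ U) : genericPoint Y ∈ U :=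
  ((genericPoint_spec Y).mem_open_set_iff U.isOpen).2 ⟨y, trivial, hy⟩

lemma exists_germToFunctionField_eq {U : Y.Opens} [Nonempty U] {h : Y.functionField}
    (hreg : ∀ y ∈ U, ∃ a : Y.presheaf.stalk y, algebraMap _ Y.functionField a = h) :
    ∃ s : Γ(Y, U), Y.germToFunctionField U s = h := by
  have hloc : ∀ y : U, ∃ (V : Y.Opens) (_ : V ≤ U) (hy : y.1 ∈ V) (s : Γ(Y, V)),
      Y.presheaf.germ V (genericPoint Y) (genericPoint_mem_of_mem hy) s = h := by
    rintro ⟨y, hy⟩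
    obtain ⟨a, ha⟩ := hreg y hy
    obtain ⟨V, hyV, s, rfl⟩ := Y.presheaf.exists_germ_eq a
    refine ⟨V ⊓ U, inf_le_right, ⟨hyV, hy⟩, Y.presheaf.map (homOfLE inf_le_left).op s, ?_⟩
    rw [Y.presheaf.germ_res_apply, ← ha, algebraMap_germ]
  choose V hVU hyV s hs using hloc
  have hcompat : TopCat.Presheaf.IsCompatible Y.presheaf V s := fun i j =>
    germ_injective_of_isIntegral Y (genericPoint Y)
      (show genericPoint Y ∈ V i ⊓ V j from
        ⟨genericPoint_mem_of_mem (hyV i), genericPoint_mem_of_mem (hyV j)⟩) <| by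
      rw [Y.presheaf.germ_res_apply, Y.presheaf.germ_res_apply, hs, hs]
  obtain ⟨t, ht, -⟩ := Y.sheaf.existsUnique_gluing' V U (fun i => homOfLE (hVU i))
    (fun y hy => Opens.mem_iSup.2 ⟨⟨y, hy⟩, hyV _⟩) s hcompat
  let y : U := Classical.arbitrary U
  exact ⟨t, (Y.presheaf.germ_res_apply (homOfLE (hVU y)) _ _ t).symm.trans
    ((congrArg _ (ht y)).trans (hs y))⟩

lemma functionFieldMap_germToFunctionField (f : X ⟶ Y) [IsDominant f] (U : Y.Opens) [Nonempty U]
    [Nonempty (f ⁻¹ᵁ U)] (s : Γ(Y, U)) :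
    functionFieldMap f (Y.germToFunctionField U s) =
      X.germToFunctionField (f ⁻¹ᵁ U) (f.app U s) := by
  obtain ⟨x, hx⟩ := (inferInstance : Nonempty (f ⁻¹ᵁ U))
  rw [← Scheme.algebraMap_germ_eq_germToFunctionField Y (show f x ∈ U from hx),
    functionFieldMap_algebraMap, Scheme.Hom.germ_stalkMap_apply,
    Scheme.algebraMap_germ_eq_germToFunctionField]

lemma isIntegralElem_of_regular_on_preimage (f : X ⟶ Y) [IsDominant f] [UniversallyClosed f]
    {U : Y.Opens} {y : Y} (hy : y ∈ U) {h : X.functionField}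
    (hreg : ∀ x, f x ∈ U → ∃ a : X.presheaf.stalk x, algebraMap _ X.functionField a = h) :
    ((functionFieldMap f).comp (algebraMap (Y.presheaf.stalk y) _)).IsIntegralElem h := by
  obtain ⟨_, ⟨V, hV, rfl⟩, hyV, hVU⟩ :=
    Y.isBasis_affineOpens.exists_subset_of_mem_open hy U.isOpen
  have : Nonempty V := ⟨⟨y, hyV⟩⟩
  have : Nonempty (f ⁻¹ᵁ V) :=
    ⟨⟨genericPoint X, by simpa [genericPoint_map] using genericPoint_mem_of_mem hyV⟩⟩
  obtain ⟨s, rfl⟩ := exists_germToFunctionField_eq (U := f ⁻¹ᵁ V) fun x hx => hreg x (hVU hx)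
  obtain ⟨P, hP, hPs⟩ := isIntegral_app_of_universallyClosed f hV s
  have hcomp : ((functionFieldMap f).comp (algebraMap (Y.presheaf.stalk y) _)).comp
        (Y.presheaf.germ V y hyV).hom =
      (X.germToFunctionField (f ⁻¹ᵁ V)).hom.comp (f.app V).hom := by
    ext t
    simpa using functionFieldMap_germToFunctionField f V t
  refine ⟨P.map (Y.presheaf.germ V y hyV).hom, hP.map _, ?_⟩
  rw [Polynomial.eval₂_map, hcomp]
  exact (Polynomial.hom_eval₂ P _ _ s).symm.trans (by rw [hPs, map_zero])

end RationalFunctions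

section Sections

lemma IsLocalEquation.exists_unit_mul_eq {L : CartierDivisor Y} {y : Y}
    {φ ψ : (Y.functionField)ˣ} (hφ : IsLocalEquation L y φ) (hψ : IsLocalEquation L y ψ) :
    ∃ c : (Y.presheaf.stalk y)ˣ,
      (φ : Y.functionField) * algebraMap _ Y.functionField (c : Y.presheaf.stalk y) = ψ := by
  obtain ⟨c, hc⟩ : φ⁻¹ * ψ ∈ stalkUnits Y y := QuotientGroup.eq.1 (hφ.symm.trans hψ)
  exact ⟨c, by simpa using congrArg Units.val (mul_eq_of_eq_inv_mul hc)⟩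

lemma vanishesAt_iff_mem_maximalIdeal {L : CartierDivisor Y} {y : Y} {φ : (Y.functionField)ˣ}
    (hφ : IsLocalEquation L y φ) {g : Y.functionField} {a : Y.presheaf.stalk y}
    (ha : algebraMap _ Y.functionField a = g * φ) :
    VanishesAt L g y ↔ a ∈ IsLocalRing.maximalIdeal (Y.presheaf.stalk y) := by
  constructor
  · intro hg
    obtain ⟨b, hb, hbg⟩ := hg φ hφ
    rwa [algebraMap_stalk_injective y (ha.trans hbg.symm)]
  · intro ham ψ hψ
    obtain ⟨c, hc⟩ := hφ.exists_unit_mul_eq hψ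
    exact ⟨a * c, Ideal.mul_mem_right _ _ ham, by rw [map_mul, ha, mul_assoc, hc]⟩

lemma mem_globalSections_of_exists {L : CartierDivisor Y} {g : Y.functionField}
    (h : ∀ y, ∃ φ, IsLocalEquation L y φ ∧
      ∃ a : Y.presheaf.stalk y, algebraMap _ Y.functionField a = g * φ) :
    g ∈ globalSections L := by
  intro y ψ hψ
  obtain ⟨φ, hφ, ha⟩ := h y
  exact exists_regular_of_isLocalEquation hφ hψ ha

variable (f : X ⟶ Y) [IsDominant f] {L : CartierDivisor Y}

lemma IsLocalEquation.pullback {x : X} {φ : (Y.functionField)ˣ}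
    (hφ : IsLocalEquation L (f x) φ) :
    IsLocalEquation (pullback f L) x (Units.map (functionFieldMap f).toMonoidHom φ) :=
  congrArg (stalkPullback f x) hφ

lemma algebraMap_stalkMap_eq_mul {x : X} {a : Y.presheaf.stalk (f x)} {g : Y.functionField}
    {φ : (Y.functionField)ˣ} (ha : algebraMap _ Y.functionField a = g * φ) :
    algebraMap _ X.functionField (f.stalkMap x a) =
      functionFieldMap f g * Units.map (functionFieldMap f).toMonoidHom φ := by
  rw [← functionFieldMap_algebraMap, ha, map_mul]
  rfl

lemma functionFieldMap_mem_globalSections {g : Y.functionField} (hg : g ∈ globalSections L) :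
    functionFieldMap f g ∈ globalSections (pullback f L) := by
  refine mem_globalSections_of_exists fun x => ?_
  obtain ⟨φ, hφ⟩ := exists_isLocalEquation L (f x)
  obtain ⟨a, ha⟩ := hg _ φ hφ
  exact ⟨_, hφ.pullback f, _, algebraMap_stalkMap_eq_mul f ha⟩

lemma vanishesAt_functionFieldMap_iff {g : Y.functionField} (hg : g ∈ globalSections L) (x : X) :
    VanishesAt (pullback f L) (functionFieldMap f g) x ↔ VanishesAt L g (f x) := by
  obtain ⟨φ, hφ⟩ := exists_isLocalEquation L (f x)
  obtain ⟨a, ha⟩ := hg _ φ hφ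
  rw [vanishesAt_iff_mem_maximalIdeal hφ ha,
    vanishesAt_iff_mem_maximalIdeal (hφ.pullback f) (algebraMap_stalkMap_eq_mul f ha)]
  exact map_mem_nonunits_iff (f.stalkMap x).hom a

lemma mem_baseLocus_of_mem_baseLocus_pullback {x : X} (hx : x ∈ baseLocus (pullback f L)) :
    f x ∈ baseLocus L := fun _ hg =>
  (vanishesAt_functionFieldMap_iff f hg x).1 (hx _ (functionFieldMap_mem_globalSections f hg))

lemma exists_isLocalEquation_isIntegralElem [UniversallyClosed f] {g : X.functionField}
    (hg : g ∈ globalSections (pullback f L)) (y : Y) :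
    ∃ φ, IsLocalEquation L y φ ∧
      ((functionFieldMap f).comp (algebraMap (Y.presheaf.stalk y) _)).IsIntegralElem
        (functionFieldMap f φ * g) := by
  obtain ⟨U, hyU, φ, hφ⟩ := (Additive.toMul L).2 y
  refine ⟨φ, hφ y hyU, isIntegralElem_of_regular_on_preimage f hyU fun x hx => ?_⟩
  rw [mul_comm]
  exact hg x _ (IsLocalEquation.pullback f (hφ (f x) hx))

lemma exists_monic_coeff_mem_globalSections [UniversallyClosed f] (hY : IsNormal Y)
    {g : X.functionField} (hg : g ∈ globalSections (pullback f L)) :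
    ∃ p : Polynomial Y.functionField, p.Monic ∧ p.eval₂ (functionFieldMap f) g = 0 ∧
      ∀ i, p.coeff i ∈ globalSections ((p.natDegree - i) • L) := by
  let : Algebra Y.functionField X.functionField := (functionFieldMap f).toAlgebra
  have hcoeff : ∀ y, ∃ φ, IsLocalEquation L y φ ∧ IsIntegral Y.functionField g ∧
      ∀ i, ∃ a : Y.presheaf.stalk y,
        algebraMap _ Y.functionField a = (minpoly Y.functionField g).coeff i *
          (φ : Y.functionField) ^ ((minpoly Y.functionField g).natDegree - i) := by
    intro y
    obtain ⟨φ, hφ, hint⟩ := exists_isLocalEquation_isIntegralElem f hg y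
    let : Algebra (Y.presheaf.stalk y) X.functionField :=
      ((functionFieldMap f).comp (algebraMap _ Y.functionField)).toAlgebra
    have : IsScalarTower (Y.presheaf.stalk y) Y.functionField X.functionField :=
      .of_algebraMap_eq' rfl
    have := hY y
    exact ⟨φ, hφ, isIntegral_of_isIntegral_smul φ.ne_zero hint,
      exists_algebraMap_eq_coeff_minpoly_mul_pow φ.ne_zero hint⟩
  obtain ⟨-, -, hgint, -⟩ := hcoeff (genericPoint Y)
  refine ⟨minpoly Y.functionField g, minpoly.monic hgint, minpoly.aeval _ g, fun i => ?_⟩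
  refine mem_globalSections_of_exists fun y => ?_
  obtain ⟨φ, hφ, -, ha⟩ := hcoeff y
  exact ⟨_, isLocalEquation_nsmul hφ _, by simpa using ha i⟩

lemma vanishesAt_of_forall_coeff_vanishesAt {g : X.functionField}
    (hg : g ∈ globalSections (pullback f L)) {p : Polynomial Y.functionField} (hp : p.Monic)
    (hpg : p.eval₂ (functionFieldMap f) g = 0)
    (hcoeff : ∀ i, p.coeff i ∈ globalSections ((p.natDegree - i) • L)) {x : X}
    (hx : ∀ i < p.natDegree, VanishesAt ((p.natDegree - i) • L) (p.coeff i) (f x)) :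
    VanishesAt (pullback f L) g x := by
  obtain ⟨φ, hφ⟩ := exists_isLocalEquation L (f x)
  obtain ⟨u, hu⟩ := hg x _ (hφ.pullback f)
  rw [vanishesAt_iff_mem_maximalIdeal (hφ.pullback f) hu]
  have hlift : p.scaleRoots φ ∈ Polynomial.lifts (algebraMap (Y.presheaf.stalk (f x)) _) := by
    refine (Polynomial.lifts_iff_coeff_lifts _).2 fun i => ?_
    simpa using hcoeff i (f x) _ (isLocalEquation_nsmul hφ _)
  obtain ⟨P, hPmap, hPdeg, hP⟩ := Polynomial.lifts_and_natDegree_eq_and_monic hlift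
    ((Polynomial.monic_scaleRoots_iff _).2 hp)
  rw [Polynomial.natDegree_scaleRoots] at hPdeg
  have hPu : P.eval₂ (f.stalkMap x).hom u = 0 := by
    apply algebraMap_stalk_injective x
    have hcomp : (algebraMap (X.presheaf.stalk x) X.functionField).comp (f.stalkMap x).hom =
        (functionFieldMap f).comp (algebraMap (Y.presheaf.stalk (f x)) Y.functionField) :=
      RingHom.ext fun a => (functionFieldMap_algebraMap f x a).symm
    rw [map_zero, Polynomial.hom_eval₂, hu, hcomp, ← Polynomial.eval₂_map, hPmap, mul_comm]
    exact Polynomial.scaleRoots_eval₂_eq_zero _ hpg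
  have hmax : (IsLocalRing.maximalIdeal _).map (f.stalkMap x).hom ≤ IsLocalRing.maximalIdeal _ :=
    ((IsLocalRing.local_hom_TFAE (f.stalkMap x).hom).out 0 2).1
      (inferInstance : IsLocalHom (f.stalkMap x).hom)
  refine mem_of_isWeaklyEisensteinAt_of_eval₂_eq_zero
    (IsLocalRing.maximalIdeal.isMaximal (X.presheaf.stalk x)).isPrime.isRadical hmax hP ⟨?_⟩ hPu
  intro i hi
  refine (vanishesAt_iff_mem_maximalIdeal (isLocalEquation_nsmul hφ _) ?_).1 (hx i (hPdeg ▸ hi))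
  rw [← Polynomial.coeff_map, hPmap, Polynomial.coeff_scaleRoots, Units.val_pow_eq_pow_val]

lemma mem_stableBaseSet_iff {y : Y} :
    y ∈ stableBaseSet L ↔ ∀ m : ℕ+, y ∈ baseLocus ((m : ℕ) • L) := by
  simp [stableBaseSet, ← SetLike.mem_coe]

lemma mem_baseLocus_pullback_of_mem_stableBaseSet [UniversallyClosed f] (hY : IsNormal Y) {x : X}
    (hx : f x ∈ stableBaseSet L) : x ∈ baseLocus (pullback f L) := by
  intro g hg
  obtain ⟨p, hp, hpg, hcoeff⟩ := exists_monic_coeff_mem_globalSections f hY hg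
  exact vanishesAt_of_forall_coeff_vanishesAt f hg hp hpg hcoeff fun i hi =>
    mem_stableBaseSet_iff.1 hx ⟨_, Nat.sub_pos_of_lt hi⟩ _ (hcoeff i)

end Sections

variable (f : X ⟶ Y) [IsDominant f] [UniversallyClosed f]

lemma stableBaseSet_pullback (hY : IsNormal Y) (L : CartierDivisor Y) :
    stableBaseSet (pullback f L) = (stableBaseSet L).preimage f.continuous := by
  ext x
  change x ∈ stableBaseSet (pullback f L) ↔ f x ∈ stableBaseSet L
  constructor <;> intro hx
  · refine mem_stableBaseSet_iff.2 fun m => mem_baseLocus_of_mem_baseLocus_pullback f ?_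
    rw [map_nsmul]
    exact mem_stableBaseSet_iff.1 hx m
  · refine mem_stableBaseSet_iff.2 fun m => ?_
    rw [← map_nsmul]
    apply mem_baseLocus_pullback_of_mem_stableBaseSet f hY
    rwa [stableBaseSet_nsmul]

lemma QDivisor.stableBaseSet_pullback (hY : IsNormal Y) (D : QDivisor Y) :
    (QDivisor.pullback f D).stableBaseSet = D.stableBaseSet.preimage f.continuous := by
  obtain ⟨b, L, hL⟩ := D.exists_cartier
  have hfL : (b : ℕ) • QDivisor.pullback f D = BaseLoci.pullback f L ⊗ₜ[ℤ] (1 : ℚ) := by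
    rw [← map_nsmul, hL]
    rfl
  rw [D.stableBaseSet_eq b L hL, stableBaseSet_eq _ b _ hfL, BaseLoci.stableBaseSet_pullback f hY]

end BaseLoci

theorem theorem3p1_general {X Y : Scheme.{u}} [IsIntegral X] [IsIntegral Y]
    (hY : BaseLoci.IsNormal Y) (f : X ⟶ Y) [IsDominant f] [UniversallyClosed f]
    (D : BaseLoci.QDivisor Y) :
    (BaseLoci.QDivisor.pullback f D).stableBaseLocus =
      BaseLoci.reducedPreimage f D.stableBaseLocus := by
  rw [BaseLoci.QDivisor.stableBaseLocus, BaseLoci.QDivisor.stableBaseSet_pullback f hY,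
    ← BaseLoci.reducedPreimage_vanishingIdeal, ← BaseLoci.QDivisor.stableBaseLocus]


theorem theorem3p1 (k : Type u) [Field k] [PerfectField k] (X Y : Scheme.{u})
    [X.Over (Spec (CommRingCat.of k))] [Y.Over (Spec (CommRingCat.of k))]
    [IsIntegral X] [IsIntegral Y]
    (hX : BaseLoci.IsProjective k X) (hY : BaseLoci.IsProjective k Y)
    (hXn : BaseLoci.IsNormal X) (hYn : BaseLoci.IsNormal Y)
    (f : X ⟶ Y) [f.IsOver (Spec (CommRingCat.of k))] [IsFinite f] [Surjective f]
    (hf : BaseLoci.IsSeparableMorphism f) (D : BaseLoci.QDivisor Y) :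
    (BaseLoci.QDivisor.pullback f D).stableBaseLocus =
      BaseLoci.reducedPreimage f D.stableBaseLocus := by
  exact theorem3p1_general hYn f D
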